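/- **Conventions.** For $p\ge 3$ let $\lambda_p=2\cos(\pi/p)$. An infinite frieze pattern is an array of real numbers $(m_{i,j})_{i,j\in\mathbb Z,\ i\le j}$ with $m_{i,i}=0$, $m_{i,i+1}=1$ and $m_{i-1,j}\,m_{i,j+1}-m_{i,j}\,m_{i-1,j+1}=1$ for all $i\le j$; its quiddity sequence is $a_i=m_{i-1,i+1}$, $i\in\mathbb Z$. Let $n\ge 1$ and $p_1,\dots,p_s\ge 3$. The frieze pattern is ($n$-periodic) of Type $\Lambda_{p_1,\dots,p_s}$ if $a_{i}=\sum_{p\in A_i}\lambda_p$ for finite multisets $A_i$ of elements of $\{p_1,\dots,p_s\}$, with $A_{i+n}=A_i$, for all $i\in\mathbb Z$. The frieze pattern is *skeletal* if for every $p\ge 3$ each string of consecutive entries $\lambda_p$ in the quiddity sequence has length smaller than $p-2$. It *passes the realizability test* if $A_i\cap A_{i+1}\ne\emptyset$ for all $i$, and there is no $p\ge 3$ such that $A_i=\{p\}$ for more than $p-2$ consecutive indices $i$ while $A_j\ne\{p\}$ for some $j$. Let $A_{n,m}$ ($m\ge1$) be the annulus with $n$ marked points $v_1,\dots,v_n$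 in cyclic order on the outer boundary and $m$ marked points on the inner boundary, and let $S_n$ be the disc with $n$ marked points $v_1,\dots,v_n$ on the boundary and one puncture, which is also a vertex. A *dissection* is a set of pairwise non-crossing arcs between these vertices (up to isotopy), none joining two inner vertices of $A_{n,m}$, that cuts the surface into polygons, called *subgons*. A dissection realizes $(a_i)$ if for all $i$ one has $a_i=\sum\lambda_p$, summed over the sizes $p$ of the subgons incident to $v_i$ (indices modulo $n$), where a subgon counts once for each of its corners at $v_i$ (equivalently, subgons are counted at a lift of $v_i$ in the universal cover; for $S_n$, in the cover branched at the puncture). A *quotient dissection* of $A_{n,m}$ is obtained from a dissection of $A_{n,m}$ by iteratively identifying pairs of distinct subgons of the same size that share an outer vertex. Subgons with all vertices on the outer boundary are never identified with another one, and no two distinct subgons that share an edge may be identified, directly or as a result of several identifications. It realizes $(a_i)$ if for all $i$ one has $a_i=\sum\lambda_p$ over the sizes $p$ of the subgons incident to $v_i$, where now all subgons that are identified with each other count as a single subgon at $v_i$ (and a subgon not identified with any other counts once for each of its corners, as before). **Theorem.** Let $\mathcal F$ be an infinite, $n$-periodic frieze pattern of Type $\Lambda_{p_1,\dots,p_s}$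 that is skeletal and passes the realizability test. Then the quiddity sequence of $\mathcal F$ is realized by a dissection of the once-punctured disc $S_n$, or by a dissection of an annulus $A_{n,m}$ for some $m\ge 1$, or by a quotient dissection of an annulus $A_{n,m}$ for some $m\ge1$. -/

import Mathlib

namespace Frieze

/-! ### Frieze patterns -/

/-- The number `λ_p = 2 cos (π / p)`. -/
noncomputable def lam (p : ℕ) : ℝ := 2 * Real.cos (Real.pi / p)

/-- An infinite frieze pattern of real numbers: an array `m i j`, of which only the entries with
`i ≤ j` are considered, with a row of zeros, a row of ones, and the unimodular rule for every
diamond with top `m i j`, left `m (i - 1) j`, right `m i (j + 1)` and bottom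
`m (i - 1) (j + 1)`. -/
structure IsInfiniteFrieze (m : ℤ → ℤ → ℝ) : Prop where
  zero_row : ∀ i, m i i = 0
  one_row : ∀ i, m i (i + 1) = 1
  unimodular : ∀ i j, i ≤ j →
    m (i - 1) j * m i (j + 1) - m i j * m (i - 1) (j + 1) = 1

/-- The quiddity sequence: the entry with index `i` is `m_{i-1,i+1}`. -/
def quiddity (m : ℤ → ℤ → ℝ) (i : ℤ) : ℝ := m (i - 1) (i + 1)

/-- The quiddity sequence `a` is `n`-periodic of Type `Λ_P`, and the multisets `A i`, with indices
modulo `n`, express its entries as sums of numbers `λ_p` with `p ∈ P`. -/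
structure IsTypeLambda (P : Finset ℕ) (n : ℕ) (a : ℤ → ℝ) (A : ℤ → Multiset ℕ) : Prop where
  periodic : ∀ i, A (i + n) = A i
  mem : ∀ i, ∀ p ∈ A i, p ∈ P
  eq_sum : ∀ i, a i = ((A i).map lam).sum

/-- A skeletal quiddity sequence: for every `p ≥ 3`, each string of consecutive entries `λ_p` has
length smaller than `p - 2`. -/
def IsSkeletal (a : ℤ → ℝ) : Prop :=
  ∀ p : ℕ, 3 ≤ p → ¬ ∃ i : ℤ, ∀ k : ℕ, k < p - 2 → a (i + k) = lam p

/-- The realizability test: neighbouring multisets have a common element, and there is no `p ≥ 3`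
for which more than `p - 2` consecutive multisets are `{p}` while some multiset is not `{p}`. -/
def PassesRealizabilityTest (A : ℤ → Multiset ℕ) : Prop :=
  (¬ ∃ i : ℤ, A i ∩ A (i + 1) = 0) ∧
  ¬ ∃ p : ℕ, 3 ≤ p ∧ (∃ i : ℤ, ∀ k : ℕ, k < p - 1 → A (i + k) = {p}) ∧ ∃ j : ℤ, A j ≠ {p}

/-! ### Dissections, drawn in the universal cover

The universal cover of an annulus is an infinite strip. The vertices of its lower boundary, the
lifts of the outer marked points, are `Sum.inl i` for `i : ℤ`; those of its upper boundary, the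
lifts of the inner marked points, are `Sum.inr j` for `j : ℤ`. For a once-punctured disc one takes
the cover branched at the puncture, so that the upper boundary is the single vertex `Sum.inr ()`.
In general, the upper vertices are indexed by `T`. Isotopy classes of arcs of the surface are
orbits of pairs of vertices of the cover under the deck transformation. -/

/-- The cyclic order of the vertices around the boundary of the cover, cut open to a linear one:
first the outer vertices from left to right, then the inner vertices from right to left. -/
def Before {T : Type} [LT T] : ℤ ⊕ T → ℤ ⊕ T → Prop
  | Sum.inl i, Sum.inl j => i < j
  | Sum.inl _, Sum.inr _ => True
  | Sum.inr _, Sum.inl _ => False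
  | Sum.inr s, Sum.inr t => t < s

/-- Boundary edges of the cover: the edges between neighbouring outer vertices, and the inner
boundary edges, given by `β`. -/
def BoundaryEdge {T : Type} (β : T → T → Prop) : ℤ ⊕ T → ℤ ⊕ T → Prop
  | Sum.inl i, Sum.inl j => j = i + 1 ∨ i = j + 1
  | Sum.inr s, Sum.inr t => β s t
  | _, _ => False

/-- A dissection of the surface with `n` outer marked points, whose inner vertices in the cover are
`T`, with deck transformation `i ↦ i + n` on outer vertices and `σ` on inner vertices. It is given
by the lifts of its arcs to the cover: a symmetric, non-crossing set of pairs of distinct vertices,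
none of them a boundary edge, invariant under the deck transformation. No arc is peripheral at the
inner boundary. There is a bridging arc, that is, all pieces are polygons. -/
structure Dissection {T : Type} [LT T] (n : ℕ) (σ : T → T) (β : T → T → Prop) where
  arc : ℤ ⊕ T → ℤ ⊕ T → Prop
  symm : ∀ x y, arc x y → arc y x
  ne : ∀ x y, arc x y → x ≠ y
  not_boundary : ∀ x y, arc x y → ¬ BoundaryEdge β x y
  not_inner : ∀ s t, ¬ arc (Sum.inr s) (Sum.inr t)
  noncrossing : ∀ x y z w, arc x y → arc z w → ¬ (Before x z ∧ Before z y ∧ Before y w)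
  invariant : ∀ x y, arc x y ↔ arc (Sum.map (· + (n : ℤ)) σ x) (Sum.map (· + (n : ℤ)) σ y)
  bridging : ∃ i t, arc (Sum.inl i) (Sum.inr t)

/-- Dissections of the annulus `A_{n,m}`. -/
abbrev AnnulusDissection (n m : ℕ) : Type :=
  Dissection n (fun j : ℤ => j + (m : ℤ)) (fun s t : ℤ => t = s + 1 ∨ s = t + 1)

/-- Dissections of the once-punctured disc `S_n`. -/
abbrev PuncturedDiscDissection (n : ℕ) : Type :=
  Dissection n (fun u : Unit => u) (fun _ _ : Unit => False)

namespace Dissection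

variable {T : Type} [LT T] {n : ℕ} {σ : T → T} {β : T → T → Prop}

/-- Edges of the dissected cover: arcs and boundary edges. -/
def Edge (D : Dissection n σ β) (x y : ℤ ⊕ T) : Prop := D.arc x y ∨ BoundaryEdge β x y

/-- A subgon of the dissected cover, given by its set of vertices: there are at least three of them,
and the edges between them are exactly the ones that join cyclically consecutive vertices (two
vertices with no other vertex of the subgon between them, or the first and the last one). Its size
is its number of vertices. -/
def IsSubgon (D : Dissection n σ β) (V : Finset (ℤ ⊕ T)) : Prop :=
  3 ≤ V.card ∧ ∀ x ∈ V, ∀ y ∈ V, Before x y →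
    (D.Edge x y ↔ (∀ z ∈ V, ¬ (Before x z ∧ Before z y)) ∨
      (∀ z ∈ V, ¬ Before z x ∧ ¬ Before y z))

/-- The two subgons have a common edge. -/
def ShareEdge (D : Dissection n σ β) (V W : Finset (ℤ ⊕ T)) : Prop :=
  ∃ x y, x ∈ V ∧ y ∈ V ∧ x ∈ W ∧ y ∈ W ∧ D.Edge x y

/-- If subgons are considered up to the equivalence relation `r`, the entry `a i` is, for every `i`,
the sum of `λ_p` over the sizes `p` of the subgons incident to the `i`-th outer vertex. Here `S` is
a system of representatives of the incident subgons. Subgons are taken at one lift of the vertex,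
so that a subgon of the surface counts once for each of its corners at the vertex, unless `r`
identifies the corresponding lifts. -/
def RealizesUpTo (D : Dissection n σ β) (r : Finset (ℤ ⊕ T) → Finset (ℤ ⊕ T) → Prop)
    (a : ℤ → ℝ) : Prop :=
  ∀ i : ℤ, ∃ S : Finset (Finset (ℤ ⊕ T)),
    (∀ V ∈ S, D.IsSubgon V ∧ Sum.inl i ∈ V) ∧
    (∀ V, D.IsSubgon V → Sum.inl i ∈ V → ∃! W, W ∈ S ∧ r V W) ∧
    a i = ∑ V ∈ S, lam V.card

/-- The entry `a i` is, for every `i`, the sum of `λ_p` over the multiset of sizes `p` of the subgons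
incident to the `i`-th outer vertex. -/
def Realizes (D : Dissection n σ β) (a : ℤ → ℝ) : Prop :=
  D.RealizesUpTo (fun V W => V = W) a

end Dissection

/-- The `k`-th power of the deck transformation of the cover of `A_{n,m}`, applied to a finite set
of vertices. Two subgons of the cover are lifts of the same subgon of `A_{n,m}` if and only if one
is a translate of the other. -/
def translate (n m : ℕ) (k : ℤ) (V : Finset (ℤ ⊕ ℤ)) : Finset (ℤ ⊕ ℤ) :=
  V.image (Sum.map (· + k * (n : ℤ)) (· + k * (m : ℤ)))

/-- A quotient dissection of `A_{n,m}`: a dissection together with a set `glue` of pairs of subgons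
of `A_{n,m}` (given by all their lifts) that get identified, where the two subgons of a pair are
distinct, have the same size, share an outer vertex, and have not all of their vertices on the outer
boundary. Iterating the identifications means passing to the generated equivalence relation; no two
distinct subgons that get identified, directly or iteratively, may share an edge. -/
structure QuotientDissection (n m : ℕ) extends AnnulusDissection n m where
  glue : Finset (ℤ ⊕ ℤ) → Finset (ℤ ⊕ ℤ) → Prop
  glue_translate : ∀ V W, glue V W → ∀ k l : ℤ, glue (translate n m k V) (translate n m l W)
  glue_subgon : ∀ V W, glue V W → toDissection.IsSubgon V ∧ toDissection.IsSubgon W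
  glue_distinct : ∀ V W, glue V W → ∀ k : ℤ, W ≠ translate n m k V
  glue_size : ∀ V W, glue V W → V.card = W.card
  glue_outer_vertex : ∀ V W, glue V W →
    ∃ i k : ℤ, Sum.inl i ∈ V ∧ Sum.inl i ∈ translate n m k W
  glue_inner_vertex : ∀ V W, glue V W → (∃ t : ℤ, Sum.inr t ∈ V) ∧ ∃ t : ℤ, Sum.inr t ∈ W
  not_shareEdge : ∀ V W, Relation.EqvGen glue V W → (∀ k : ℤ, W ≠ translate n m k V) →
    ¬ toDissection.ShareEdge V W

/-- The quotient dissection realizes `a`: all subgons that are identified count as one subgon. As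
`glue` is invariant under translating either subgon, the relation generated by it identifies all
lifts of all subgons in a class of at least two identified subgons, and leaves the lifts of the
other subgons distinct. -/
def QuotientDissection.Realizes {n m : ℕ} (Q : QuotientDissection n m) (a : ℤ → ℝ) : Prop :=
  Q.toDissection.RealizesUpTo (Relation.EqvGen Q.glue) a

/-- The sequence `a` is realizable by a dissection of `S_n`. -/
def RealizableByPuncturedDisc (n : ℕ) (a : ℤ → ℝ) : Prop :=
  ∃ D : PuncturedDiscDissection n, D.Realizes a

/-- The sequence `a` is realizable by a dissection of `A_{n,m}` for some `m ≥ 1`. -/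
def RealizableByAnnulus (n : ℕ) (a : ℤ → ℝ) : Prop :=
  ∃ m : ℕ, 1 ≤ m ∧ ∃ D : AnnulusDissection n m, D.Realizes a

/-- The sequence `a` is realizable by a quotient dissection of `A_{n,m}` for some `m ≥ 1`. -/
def RealizableByQuotient (n : ℕ) (a : ℤ → ℝ) : Prop :=
  ∃ m : ℕ, 1 ≤ m ∧ ∃ Q : QuotientDissection n m, Q.Realizes a

end Frieze

namespace Frieze

/-! ### Dissections with bridging arcs only -/

/-! A quotient dissection always exists, and all its arcs can be taken bridging. Pick `q i` in `A i
∩ A (i + 1)`; this is the size of the subgon containing the outer edge from `i` to `i + 1`. Around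
the vertex `i`, write a word of letters (size, tag) that starts with size `q (i - 1)`, ends with
size `q i`, never repeats a letter in adjacent places, and whose distinct letters have exactly the
sizes in `A i` (`exists_isFan`). The last subgon at `i` is the first one at `i + 1`, so the words
overlap to a single periodic sequence of subgons. A vertex with `A i = {p}` receives no arc and is
merely passed over by a `p`-gon.

A `p`-gon with `d` outer edges needs `p - 2 - d` inner ones. The skeletal condition makes this
number nonnegative (`FanSeq.sub_le`), and summing it gives the inner endpoints of the arcs
(`FanSeq.exists_arcSeq`).

Now identify subgons that have the same letter and share an outer vertex. The letter is constant on
each class, so different letters at a vertex stay different; equal letters at a vertex do get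
identified (`FanSeq.eqvGen_of_eq`); and subgons sharing an edge have different letters. Hence each
vertex sees each element of `A i` once. -/

/-- The arcs of a dissection of the annulus `A_{n,m}` all of whose arcs are bridging, enumerated in
the cover from left to right: the `k`-th arc joins the outer vertex `o k` to the inner vertex
`t k`. The surface has `N` arcs. -/
structure ArcSeq (n m N : ℕ) where
  o : ℤ → ℤ
  t : ℤ → ℤ
  o_le : ∀ k, o k ≤ o (k + 1)
  t_le : ∀ k, t k ≤ t (k + 1)
  lt : ∀ k, o k + t k < o (k + 1) + t (k + 1)
  o_period : ∀ k, o (k + N) = o k + n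
  t_period : ∀ k, t (k + N) = t k + m

namespace ArcSeq

variable {n m N : ℕ} (S : ArcSeq n m N)

theorem o_mono : Monotone S.o := monotone_int_of_le_succ S.o_le

theorem t_mono : Monotone S.t := monotone_int_of_le_succ S.t_le

theorem strictMono : StrictMono fun k => S.o k + S.t k := strictMono_int_of_lt_succ S.lt

/-- The relation of being joined by one of the arcs. -/
def Arc : ℤ ⊕ ℤ → ℤ ⊕ ℤ → Prop
  | Sum.inl i, Sum.inr s => ∃ k, S.o k = i ∧ S.t k = s
  | Sum.inr s, Sum.inl i => ∃ k, S.o k = i ∧ S.t k = s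
  | _, _ => False

theorem arc_exists_iff (i s : ℤ) : (∃ k, S.o k = i ∧ S.t k = s) ↔
    ∃ k, S.o k = i + n ∧ S.t k = s + m := by
  constructor
  · rintro ⟨k, rfl, rfl⟩
    exact ⟨k + N, S.o_period k, S.t_period k⟩
  · rintro ⟨k, ho, ht⟩
    have h1 := S.o_period (k - N)
    have h2 := S.t_period (k - N)
    rw [sub_add_cancel] at h1 h2
    exact ⟨k - N, by lia, by lia⟩

/-- The dissection with the given arcs. -/
noncomputable def dissection : AnnulusDissection n m where
  arc := S.Arc
  symm := by rintro (i | s) (j | u) h <;> exact h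
  ne := by rintro (i | s) (j | u) h <;> simp_all [Arc]
  not_boundary := by rintro (i | s) (j | u) h <;> simp_all [Arc, BoundaryEdge]
  not_inner := by simp [Arc]
  noncrossing := by
    rintro (x | x) (y | y) (z | z) (w | w) h1 h2 <;>
      simp only [Arc, Before, not_and, not_lt, not_true, imp_false, not_false_eq_true,
        IsEmpty.forall_iff, implies_true, forall_const] at h1 h2 ⊢
    obtain ⟨k, rfl, rfl⟩ := h1
    obtain ⟨l, rfl, rfl⟩ := h2
    intro h
    -- Inner vertices are ordered from right to left, so a crossing would require `o k < o l` and `t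
    -- l < t k`.
    exact S.t_mono (S.o_mono.reflect_lt h).le
  invariant := by
    rintro (i | s) (j | u)
    · simp [Arc]
    · exact S.arc_exists_iff i u
    · exact S.arc_exists_iff j s
    · simp [Arc]
  bridging := ⟨S.o 0, S.t 0, 0, rfl, rfl⟩

/-- The subgon between the `k`-th arc and the next one. -/
noncomputable def gon (k : ℤ) : Finset (ℤ ⊕ ℤ) :=
  (Finset.Icc (S.o k) (S.o (k + 1))).disjSum (Finset.Icc (S.t k) (S.t (k + 1)))

theorem inl_mem_gon {i k : ℤ} : Sum.inl i ∈ S.gon k ↔ S.o k ≤ i ∧ i ≤ S.o (k + 1) := by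
  simp [gon]

theorem inr_mem_gon {s k : ℤ} : Sum.inr s ∈ S.gon k ↔ S.t k ≤ s ∧ s ≤ S.t (k + 1) := by
  simp [gon]

theorem card_gon (k : ℤ) :
    ((S.gon k).card : ℤ) = (S.o (k + 1) - S.o k) + (S.t (k + 1) - S.t k) + 2 := by
  have h1 := S.o_le k
  have h2 := S.t_le k
  simp only [gon, Finset.card_disjSum, Int.card_Icc]
  lia

theorem eq_or_eq_of_mem {k l : ℤ} (h1 : S.o k ≤ S.o l) (h2 : S.o l ≤ S.o (k + 1))
    (h3 : S.t k ≤ S.t l) (h4 : S.t l ≤ S.t (k + 1)) : l = k ∨ l = k + 1 := by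
  have h5 : k ≤ l := S.strictMono.le_iff_le.1 (add_le_add h1 h3)
  have h6 : l ≤ k + 1 := S.strictMono.le_iff_le.1 (add_le_add h2 h4)
  lia

theorem gon_injective : Function.Injective S.gon := by
  intro k l h
  have key : ∀ k l, S.gon k = S.gon l → k ≤ l := by
    intro k l h
    have h1 : Sum.inl (S.o l) ∈ S.gon k := h ▸ S.inl_mem_gon.2 ⟨le_rfl, S.o_le l⟩
    have h2 : Sum.inr (S.t l) ∈ S.gon k := h ▸ S.inr_mem_gon.2 ⟨le_rfl, S.t_le l⟩
    exact S.strictMono.le_iff_le.1 (add_le_add (S.inl_mem_gon.1 h1).1 (S.inr_mem_gon.1 h2).1)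
  exact le_antisymm (key k l h) (key l k h.symm)

theorem period_zsmul (z k : ℤ) :
    S.o (k + z * N) = S.o k + z * n ∧ S.t (k + z * N) = S.t k + z * m := by
  induction z using Int.induction_on with
  | zero => simp
  | succ z ih =>
    have h1 := S.o_period (k + z * N)
    have h2 := S.t_period (k + z * N)
    rw [show k + (z + 1 : ℤ) * N = k + z * N + N by ring, h1, h2, ih.1, ih.2]
    constructor <;> ring
  | pred z ih =>
    have h1 := S.o_period (k + (-z - 1 : ℤ) * N)
    have h2 := S.t_period (k + (-z - 1 : ℤ) * N)
    rw [show k + (-z - 1 : ℤ) * N + N = k + -z * N by ring] at h1 h2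
    constructor <;> linarith [ih.1, ih.2]

theorem translate_gon (z k : ℤ) : translate n m z (S.gon k) = S.gon (k + z * N) := by
  have h1 := S.period_zsmul z k
  have h2 := S.period_zsmul z (k + 1)
  rw [show k + 1 + z * N = k + z * N + 1 by ring] at h2
  ext (i | s)
  · rw [inl_mem_gon, h1.1, h2.1]
    simp only [translate, Finset.mem_image, Sum.exists, inl_mem_gon, Sum.map_inl, Sum.inl.injEq,
      Sum.map_inr, reduceCtorEq, and_false, exists_false, or_false]
    exact ⟨by rintro ⟨a, h, rfl⟩; lia, fun h => ⟨i - z * n, by lia, by lia⟩⟩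
  · rw [inr_mem_gon, h1.2, h2.2]
    simp only [translate, Finset.mem_image, Sum.exists, inr_mem_gon, Sum.map_inl, Sum.inr.injEq,
      Sum.map_inr, reduceCtorEq, and_false, exists_false, false_or]
    exact ⟨by rintro ⟨a, h, rfl⟩; lia, fun h => ⟨s - z * m, by lia, by lia⟩⟩

theorem isSubgon_gon (k : ℤ) : S.dissection.IsSubgon (S.gon k) := by
  have ho := S.o_le k
  have ht := S.t_le k
  have hc := S.card_gon k
  have hl := S.lt k
  refine ⟨by lia, ?_⟩
  rintro (i | s) hx (j | u) hy hb
  · rw [inl_mem_gon] at hx hy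
    simp only [Before] at hb
    simp only [Dissection.Edge, dissection, Arc, BoundaryEdge, false_or]
    constructor
    · intro h
      refine Or.inl ?_
      rintro (z | z) -
      · simp only [Before]; lia
      · simp [Before]
    · rintro (h | h)
      · have := h (Sum.inl (i + 1)) (S.inl_mem_gon.2 (by lia))
        simp only [Before] at this
        lia
      · have := h (Sum.inr (S.t k)) (S.inr_mem_gon.2 (by lia))
        simp [Before] at this
  · rw [inl_mem_gon] at hx
    rw [inr_mem_gon] at hy
    simp only [Dissection.Edge, dissection, Arc, BoundaryEdge, or_false]
    constructor
    · rintro ⟨l, rfl, rfl⟩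
      rcases S.eq_or_eq_of_mem hx.1 hx.2 hy.1 hy.2 with rfl | rfl
      · refine Or.inr ?_
        rintro (z | z) hz
        · rw [inl_mem_gon] at hz
          simp only [Before]; lia
        · rw [inr_mem_gon] at hz
          simp only [Before]; lia
      · refine Or.inl ?_
        rintro (z | z) hz
        · rw [inl_mem_gon] at hz
          simp only [Before]; lia
        · rw [inr_mem_gon] at hz
          simp only [Before]; lia
    · rintro (h | h)
      · have h1 := h (Sum.inl (S.o (k + 1))) (S.inl_mem_gon.2 (by lia))
        have h2 := h (Sum.inr (S.t (k + 1))) (S.inr_mem_gon.2 (by lia))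
        simp only [Before] at h1 h2
        exact ⟨k + 1, by lia, by lia⟩
      · have h1 := h (Sum.inl (S.o k)) (S.inl_mem_gon.2 (by lia))
        have h2 := h (Sum.inr (S.t k)) (S.inr_mem_gon.2 (by lia))
        simp only [Before] at h1 h2
        exact ⟨k, by lia, by lia⟩
  · simp [Before] at hb
  · rw [inr_mem_gon] at hx hy
    simp only [Before] at hb
    simp only [Dissection.Edge, dissection, Arc, BoundaryEdge, false_or]
    constructor
    · intro h
      refine Or.inl ?_
      rintro (z | z) -
      · simp [Before]
      · simp only [Before]; lia
    · rintro (h | h)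
      · have := h (Sum.inr (u + 1)) (S.inr_mem_gon.2 (by lia))
        simp only [Before] at this
        lia
      · have := h (Sum.inl (S.o k)) (S.inl_mem_gon.2 (by lia))
        simp [Before] at this

end ArcSeq

/-- A finite set of integers without gaps between consecutive elements is an interval. -/
theorem mem_of_consecutive {O : Finset ℤ}
    (h : ∀ x ∈ O, ∀ y ∈ O, x < y → (∀ z ∈ O, ¬ (x < z ∧ z < y)) → y = x + 1)
    {a b x : ℤ} (ha : a ∈ O) (hb : b ∈ O) (hax : a ≤ x) (hxb : x ≤ b) : x ∈ O := by
  induction x, hax using Int.leInduction with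
  | base => exact ha
  | succ x hx ih =>
    have hne : (O.filter (x < ·)).Nonempty := ⟨b, by simp [hb]; lia⟩
    have hw := Finset.min'_mem _ hne
    rw [Finset.mem_filter] at hw
    rw [← h x (ih (by lia)) _ hw.1 hw.2 fun z hz hxz =>
      absurd (Finset.min'_le _ z (Finset.mem_filter.2 ⟨hz, hxz.1⟩)) (by lia)]
    exact hw.1

namespace ArcSeq

variable {n m N : ℕ} (S : ArcSeq n m N)

/-- As all arcs bridge, sides between two outer or two inner vertices are boundary edges. So `V`
meets both boundaries, in an interval each, and the two sides joining the ends of these intervals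
are arcs `k ≤ l`. They are consecutive, since otherwise the arc `k + 1` would be a diagonal. -/
theorem exists_eq_gon {V : Finset (ℤ ⊕ ℤ)} (hV : S.dissection.IsSubgon V) :
    ∃ k, V = S.gon k := by
  obtain ⟨hcard, hE⟩ := hV
  set O := V.toLeft with hO
  set I := V.toRight with hI
  have hVc : V.card = O.card + I.card := Finset.card_toLeft_add_card_toRight.symm
  have mO : ∀ i, Sum.inl i ∈ V ↔ i ∈ O := fun i => by simp [hO]
  have mI : ∀ i, Sum.inr i ∈ V ↔ i ∈ I := fun i => by simp [hI]
  have hOne : O.Nonempty := by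
    by_contra hemp
    rw [Finset.not_nonempty_iff_eq_empty] at hemp
    rw [hemp, Finset.card_empty, zero_add] at hVc
    have hIne : I.Nonempty := Finset.card_pos.1 (by lia)
    have hle := I.min'_le_max' hIne
    have hsub : I ⊆ Finset.Icc (I.min' hIne) (I.max' hIne) := fun x hx =>
      Finset.mem_Icc.2 ⟨I.min'_le x hx, I.le_max' x hx⟩
    have hc := Finset.card_le_card hsub
    rw [Int.card_Icc] at hc
    have := (hE (Sum.inr (I.max' hIne)) ((mI _).2 (I.max'_mem hIne)) (Sum.inr (I.min' hIne))
      ((mI _).2 (I.min'_mem hIne)) (by simp only [Before]; lia)).2 (Or.inr (by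
        rintro (z | z) hz
        · simp [mO, hemp] at hz
        · have h1 := I.min'_le z ((mI z).1 hz)
          have h2 := I.le_max' z ((mI z).1 hz)
          simp only [Before]; lia))
    simp only [Dissection.Edge, dissection, Arc, BoundaryEdge, false_or] at this
    lia
  have hIne : I.Nonempty := by
    by_contra hemp
    rw [Finset.not_nonempty_iff_eq_empty] at hemp
    rw [hemp, Finset.card_empty, add_zero] at hVc
    have hle := O.min'_le_max' hOne
    have hsub : O ⊆ Finset.Icc (O.min' hOne) (O.max' hOne) := fun x hx =>
      Finset.mem_Icc.2 ⟨O.min'_le x hx, O.le_max' x hx⟩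
    have hc := Finset.card_le_card hsub
    rw [Int.card_Icc] at hc
    have := (hE (Sum.inl (O.min' hOne)) ((mO _).2 (O.min'_mem hOne)) (Sum.inl (O.max' hOne))
      ((mO _).2 (O.max'_mem hOne)) (by simp only [Before]; lia)).2 (Or.inr (by
        rintro (z | z) hz
        · have h1 := O.min'_le z ((mO z).1 hz)
          have h2 := O.le_max' z ((mO z).1 hz)
          simp only [Before]; lia
        · simp [mI, hemp] at hz))
    simp only [Dissection.Edge, dissection, Arc, BoundaryEdge, false_or] at this
    lia
  have hOmem : ∀ x, x ∈ O ↔ O.min' hOne ≤ x ∧ x ≤ O.max' hOne := fun x => by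
    refine ⟨fun hx => ⟨O.min'_le x hx, O.le_max' x hx⟩, fun hx => mem_of_consecutive ?_
      (O.min'_mem hOne) (O.max'_mem hOne) hx.1 hx.2⟩
    intro x hx y hy hxy h
    have := (hE (Sum.inl x) ((mO x).2 hx) (Sum.inl y) ((mO y).2 hy) hxy).2 (Or.inl (by
      rintro (z | z) hz
      · exact h z ((mO z).1 hz)
      · simp [Before]))
    simp only [Dissection.Edge, dissection, Arc, BoundaryEdge, false_or] at this
    lia
  have hImem : ∀ x, x ∈ I ↔ I.min' hIne ≤ x ∧ x ≤ I.max' hIne := fun x => by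
    refine ⟨fun hx => ⟨I.min'_le x hx, I.le_max' x hx⟩, fun hx => mem_of_consecutive ?_
      (I.min'_mem hIne) (I.max'_mem hIne) hx.1 hx.2⟩
    intro x hx y hy hxy h
    have := (hE (Sum.inr y) ((mI y).2 hy) (Sum.inr x) ((mI x).2 hx) hxy).2 (Or.inl (by
      rintro (z | z) hz
      · simp [Before]
      · exact fun h' => h z ((mI z).1 hz) ⟨h'.2, h'.1⟩))
    simp only [Dissection.Edge, dissection, Arc, BoundaryEdge, false_or] at this
    lia
  have hfirst := (hE (Sum.inl (O.min' hOne)) ((mO _).2 (O.min'_mem hOne)) (Sum.inr (I.min' hIne))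
    ((mI _).2 (I.min'_mem hIne)) (by simp only [Before])).2 (Or.inr (by
      rintro (z | z) hz
      · have := O.min'_le z ((mO z).1 hz)
        simp only [Before]; lia
      · have := I.min'_le z ((mI z).1 hz)
        simp only [Before]; lia))
  have hlast := (hE (Sum.inl (O.max' hOne)) ((mO _).2 (O.max'_mem hOne)) (Sum.inr (I.max' hIne))
    ((mI _).2 (I.max'_mem hIne)) (by simp only [Before])).2 (Or.inl (by
      rintro (z | z) hz
      · have := O.le_max' z ((mO z).1 hz)
        simp only [Before]; lia
      · have := I.le_max' z ((mI z).1 hz)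
        simp only [Before]; lia))
  have hOle := O.min'_le_max' hOne
  have hIle := I.min'_le_max' hIne
  simp only [Dissection.Edge, dissection, Arc, BoundaryEdge, or_false] at hfirst hlast
  obtain ⟨k, hk1, hk2⟩ := hfirst
  obtain ⟨l, hl1, hl2⟩ := hlast
  rw [← hk1, ← hl1] at hOmem hOle
  rw [← hk2, ← hl2] at hImem hIle
  have hkl : k ≤ l := S.strictMono.le_iff_le.1 (add_le_add hOle hIle)
  have hne : k ≠ l := by
    rintro rfl
    have h1 : O ⊆ {S.o k} := fun x hx => by
      have := (hOmem x).1 hx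
      simp; lia
    have h2 : I ⊆ {S.t k} := fun x hx => by
      have := (hImem x).1 hx
      simp; lia
    have h3 := Finset.card_le_card h1
    have h4 := Finset.card_le_card h2
    simp only [Finset.card_singleton] at h3 h4
    lia
  -- The arc `k + 1` joins two vertices of `V`, hence is a side. It cannot be the leftmost one, as
  -- it differs from the arc `k`, so it is the rightmost one.
  have hkl1 : l = k + 1 := by
    have e1 : S.o k ≤ S.o (k + 1) := S.o_le k
    have e2 : S.t k ≤ S.t (k + 1) := S.t_le k
    have e3 : S.o (k + 1) ≤ S.o l := S.o_mono (by lia)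
    have e4 : S.t (k + 1) ≤ S.t l := S.t_mono (by lia)
    have e5 := S.lt k
    rcases (hE (Sum.inl (S.o (k + 1))) ((mO _).2 ((hOmem _).2 ⟨e1, e3⟩)) (Sum.inr (S.t (k + 1)))
      ((mI _).2 ((hImem _).2 ⟨e2, e4⟩)) (by simp only [Before])).1 (Or.inl ⟨k + 1, rfl, rfl⟩)
      with h | h
    · have h1 := h (Sum.inl (S.o l)) ((mO _).2 ((hOmem _).2 ⟨hOle, le_rfl⟩))
      have h2 := h (Sum.inr (S.t l)) ((mI _).2 ((hImem _).2 ⟨hIle, le_rfl⟩))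
      simp only [Before] at h1 h2
      have := S.strictMono.le_iff_le.1 (show S.o l + S.t l ≤ S.o (k + 1) + S.t (k + 1) by lia)
      lia
    · have h1 := h (Sum.inl (S.o k)) ((mO _).2 ((hOmem _).2 ⟨le_rfl, hOle⟩))
      have h2 := h (Sum.inr (S.t k)) ((mI _).2 ((hImem _).2 ⟨le_rfl, hIle⟩))
      simp only [Before] at h1 h2
      lia
  subst hkl1
  refine ⟨k, ?_⟩
  ext (i | s)
  · rw [mO, hOmem, inl_mem_gon]
  · rw [mI, hImem, inr_mem_gon]

/-- The first subgon lies weakly left of the arc `k + 1` and the second weakly right of the arc `l`.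
A common edge forces these two arcs to coincide. -/
theorem eq_succ_of_shareEdge {k l : ℤ} (hkl : k < l)
    (h : S.dissection.ShareEdge (S.gon k) (S.gon l)) : l = k + 1 := by
  have ho : S.o (k + 1) ≤ S.o l := S.o_mono (by lia)
  have ht : S.t (k + 1) ≤ S.t l := S.t_mono (by lia)
  obtain ⟨x, y, hx, hy, hx', hy', he⟩ := h
  suffices hs : S.o (k + 1) = S.o l ∧ S.t (k + 1) = S.t l from
    (S.strictMono.injective (by simp only [hs.1, hs.2])).symm
  rcases x with i | s <;> rcases y with j | u <;> simp only [inl_mem_gon, inr_mem_gon] at hx hy hx' hy' <;>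
    simp only [Dissection.Edge, dissection, Arc, BoundaryEdge, false_or] at he <;> lia

end ArcSeq

/-! ### Fans of subgons at an outer vertex -/

/-- The subgons incident to an outer vertex, listed from left to right as `F 0, …, F L`. A subgon
is described by its size and a tag, and two of them are to be identified if they agree in both.
The first and the last subgon have sizes `p` and `q` and the tag `0`, neighbouring subgons are not
identified, and the sizes up to identification form the multiset `A`. -/
structure IsFan (p q : ℕ) (A : Multiset ℕ) (L : ℕ) (F : ℕ → ℕ × ℕ) : Prop where
  first : F 0 = (p, 0)
  last : F L = (q, 0)
  ne_succ : ∀ j < L, F j ≠ F (j + 1)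
  sum_eq : ∑ ℓ ∈ (Finset.range (L + 1)).image F, lam ℓ.1 = (A.map lam).sum
  mem : ∀ j ≤ L, (F j).1 ∈ A
  eq_singleton : L = 0 → A = {p}
  length : A ≠ {p} → 2 ≤ L
  middle : L ≠ 0 → p = q → ∃ j, 0 < j ∧ j < L ∧ F j = F 0

/-- The elements of a multiset, distinguished by positive tags. -/
noncomputable def tagged (B : Multiset ℕ) : List (ℕ × ℕ) := B.toList.zipIdx 1

theorem tagged_nodup (B : Multiset ℕ) : (tagged B).Nodup := by
  refine List.Nodup.of_map Prod.snd ?_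
  rw [tagged, List.zipIdx_map_snd]
  exact List.nodup_range'

theorem map_fst_tagged (B : Multiset ℕ) : (tagged B).map Prod.fst = B.toList :=
  List.zipIdx_map_fst ..

theorem snd_pos_of_mem_tagged {B : Multiset ℕ} {x : ℕ × ℕ} (h : x ∈ tagged B) : 0 < x.2 :=
  List.le_snd_of_mem_zipIdx h

/-- The list `M` names every letter once and so carries the sum; `l` is a word in the same letters
with repetitions. -/
theorem isFan_of_list {p q : ℕ} {A : Multiset ℕ} {l M : List (ℕ × ℕ)} (hM : M.Nodup)
    (hmem : ∀ x, x ∈ l ↔ x ∈ M) (hMA : ((M.map Prod.fst : List ℕ) : Multiset ℕ) = A)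
    (h0 : l.head? = some (p, 0)) (hL : l.getLast? = some (q, 0))
    (hchain : l.IsChain (· ≠ ·)) (h1 : l.length = 1 → A = {p}) (h2 : A ≠ {p} → 3 ≤ l.length)
    (h3 : l.length ≠ 1 → p = q → ∃ j, 0 < j ∧ j < l.length - 1 ∧ l[j]? = some (p, 0)) :
    IsFan p q A (l.length - 1) (fun j => l.getD j (0, 0)) := by
  have hpos : 0 < l.length := by
    rcases l with - | ⟨x, l⟩
    · simp at h0
    · simp
  have hF0 : l.getD 0 (0, 0) = (p, 0) := by
    rw [List.getD_eq_getElem?_getD, ← List.head?_eq_getElem?, h0]; rfl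
  have himg : (Finset.range (l.length - 1 + 1)).image (fun j => l.getD j (0, 0)) = M.toFinset := by
    ext x
    rw [List.mem_toFinset, ← hmem, List.mem_iff_getElem, Finset.mem_image]
    constructor
    · rintro ⟨j, hj, rfl⟩
      have hj' : j < l.length := by rw [Finset.mem_range] at hj; lia
      exact ⟨j, hj', by simp [hj']⟩
    · rintro ⟨j, hj, rfl⟩
      exact ⟨j, Finset.mem_range.2 (by lia), by simp [hj]⟩
  constructor
  · exact hF0
  · simp only [List.getD_eq_getElem?_getD, ← List.getLast?_eq_getElem?, hL, Option.getD_some]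
  · intro j hj
    have := List.isChain_iff_getElem.1 hchain j (by lia)
    simpa [List.getD_eq_getElem?_getD, show j < l.length by lia,
      show j + 1 < l.length by lia] using this
  · rw [himg, List.sum_toFinset _ hM, ← hMA, Multiset.map_coe, Multiset.sum_coe, List.map_map]
    rfl
  · intro j hj
    have hj' : j < l.length := by lia
    rw [← hMA, Multiset.mem_coe, List.mem_map]
    exact ⟨_, (hmem _).1 (List.getElem_mem hj'), by simp [hj']⟩
  · exact fun h => h1 (by lia)
  · exact fun h => by have := h2 h; lia
  · intro h hpq
    obtain ⟨j, hj0, hj1, hj⟩ := h3 (by lia) hpq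
    exact ⟨j, hj0, hj1, by rw [hF0, List.getD_eq_getElem?_getD, hj]; rfl⟩

theorem isChain_append_self {α : Type*} {M : List α} (hM : M.Nodup) (hl : 2 ≤ M.length) :
    (M ++ M).IsChain (· ≠ ·) := by
  rw [List.isChain_append]
  refine ⟨hM.isChain, hM.isChain, ?_⟩
  intro x hx y hy hxy
  subst hxy
  rw [List.getLast?_eq_getElem?, Option.mem_def] at hx
  rw [List.head?_eq_getElem?, Option.mem_def] at hy
  rw [List.getElem?_eq_some_iff] at hx hy
  obtain ⟨h1, h2⟩ := hx
  obtain ⟨h3, h4⟩ := hy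
  have := (hM.getElem_inj_iff (hi := h1) (hj := h3)).1 (h2.trans h4.symm)
  lia

/-- Letters are repeated on purpose. At least two arcs at a vertex are needed to get a positive
number of inner marked points. If `p = q`, the first and last subgon may be lifts of one subgon of
the surface, which cannot be glued to itself; both are then glued to a copy strictly between them.
-/
theorem exists_isFan (p q : ℕ) (A : Multiset ℕ) (hp : p ∈ A) (hq : q ∈ A) :
    ∃ L F, IsFan p q A L F := by
  obtain ⟨B, rfl⟩ := Multiset.exists_cons_of_mem hp
  have hnot : ∀ (C : Multiset ℕ) (r : ℕ), (r, 0) ∉ tagged C := fun C r h =>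
    absurd (snd_pos_of_mem_tagged h) (lt_irrefl 0)
  by_cases hB : B = 0
  · subst hB
    obtain rfl : q = p := by simpa using hq
    exact ⟨_, _, isFan_of_list (l := [(q, 0)]) (M := [(q, 0)]) (by simp) (by simp) (by simp)
      (by simp) (by simp) (by simp) (by simp) (by simp) (by simp)⟩
  have hBpos : 0 < B.card := Multiset.card_pos.2 hB
  by_cases hpq : p = q
  · subst hpq
    have hlen : (tagged B).length = B.card := by simp [tagged]
    have hM : ((p, 0) :: tagged B).Nodup := by simp [tagged_nodup, hnot]
    have hlM : ((p, 0) :: tagged B).length = B.card + 1 := by simp [hlen]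
    -- The start of the second block is the intermediate copy of `(p, 0)`, at position `B.card + 1`.
    refine ⟨_, _, isFan_of_list (l := ((p, 0) :: tagged B) ++ ((p, 0) :: tagged B) ++ [(p, 0)])
      (M := (p, 0) :: tagged B) hM (by intro x; simp; tauto) ?_ (by simp)
      (by rw [List.getLast?_append_of_ne_nil _ (by simp)]; rfl) ?_ ?_ ?_ ?_⟩
    · rw [List.map_cons, map_fst_tagged, ← Multiset.cons_coe, Multiset.coe_toList]
    · rw [List.isChain_append]
      refine ⟨isChain_append_self hM (by lia), by simp, ?_⟩
      intro x hx y hy hxy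
      obtain ⟨b, D, hD⟩ : ∃ b D, tagged B = b :: D :=
        List.exists_cons_of_length_pos (by lia)
      have hx' : x ∈ tagged B := by
        rw [hD]
        rw [hD, List.cons_append, List.getLast?_cons_of_ne_nil (by simp),
          List.getLast?_append_of_ne_nil _ (by simp), List.getLast?_cons_of_ne_nil (by simp)] at hx
        exact List.mem_of_getLast? hx
      obtain rfl : (p, 0) = y := by simpa using hy
      exact hnot B p (hxy ▸ hx')
    · intro h
      simp only [List.length_append, hlM] at h
      lia
    · intro _
      simp only [List.length_append, hlM]
      lia
    · rintro - -
      refine ⟨B.card + 1, by lia, ?_, ?_⟩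
      · simp only [List.length_append, hlM]
        simp
      · rw [List.append_assoc, List.getElem?_append_right (by lia), hlM]
        simp
  · obtain ⟨R, rfl⟩ := Multiset.exists_cons_of_mem
      ((Multiset.mem_cons.1 hq).resolve_left (Ne.symm hpq))
    have hlen : (tagged R).length = R.card := by simp [tagged]
    have hM : ((p, 0) :: (tagged R ++ [(q, 0)])).Nodup := by
      rw [List.nodup_cons, List.nodup_append]
      refine ⟨by simp [hnot, hpq], tagged_nodup R, by simp, ?_⟩
      intro x hx y hy hxy
      rw [List.mem_singleton] at hy
      exact hnot R q (hy ▸ hxy ▸ hx)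
    have hlM : ((p, 0) :: (tagged R ++ [(q, 0)])).length = R.card + 2 := by simp [hlen]
    -- One block would do for the sum, but it has only two letters if `R = 0`; doubling it
    -- guarantees at least three subgons.
    refine ⟨_, _, isFan_of_list
      (l := ((p, 0) :: (tagged R ++ [(q, 0)])) ++ ((p, 0) :: (tagged R ++ [(q, 0)])))
      (M := (p, 0) :: (tagged R ++ [(q, 0)])) hM (by intro x; simp; tauto) ?_ (by simp) ?_
      (isChain_append_self hM (by lia)) ?_ ?_ (fun _ h => absurd h hpq)⟩
    · rw [List.map_cons, List.map_append, map_fst_tagged, ← Multiset.cons_coe,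
        ← Multiset.coe_add, Multiset.coe_toList, List.map_singleton, Multiset.coe_singleton,
        add_comm, Multiset.singleton_add]
    · rw [← List.cons_append, ← List.append_assoc, List.getLast?_append_of_ne_nil _ (by simp)]
      simp
    · intro h
      simp only [List.length_append, hlM] at h
      lia
    · intro _
      simp only [List.length_append, hlM]
      lia

/-! ### Auxiliary facts on translates and periodic sequences -/

theorem translate_zero (n m : ℕ) (V : Finset (ℤ ⊕ ℤ)) : translate n m 0 V = V := by
  ext (i | s) <;> simp [translate]

theorem exists_antidifference (f : ℤ → ℤ) : ∃ S : ℤ → ℤ, ∀ k, S (k + 1) = S k + f k := by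
  refine ⟨fun k => match k with
    | Int.ofNat a => ∑ i ∈ Finset.range a, f i
    | Int.negSucc a => -∑ i ∈ Finset.range (a + 1), f (Int.negSucc i), ?_⟩
  rintro (a | _ | a)
  · exact Finset.sum_range_succ _ a
  · simp
  · change -∑ i ∈ Finset.range (a + 1), f (Int.negSucc i) =
      -∑ i ∈ Finset.range (a + 1 + 1), f (Int.negSucc i) + f (Int.negSucc (a + 1))
    rw [Finset.sum_range_succ _ (a + 1)]
    ring

theorem add_period_of_antidifference {f S : ℤ → ℤ} {N : ℤ} (hS : ∀ k, S (k + 1) = S k + f k)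
    (hf : ∀ k, f (k + N) = f k) (k : ℤ) : S (k + N) = S k + (S N - S 0) := by
  induction k using Int.induction_on with
  | zero => simp
  | succ k ih => rw [add_right_comm, hS, hS, hf, ih]; ring
  | pred k ih =>
    have h1 := hS (-k - 1)
    have h2 := hS (-k - 1 + N)
    rw [sub_add_cancel] at h1
    rw [show -(k : ℤ) - 1 + N + 1 = -k + N by ring, hf] at h2
    lia

/-- A monotone function of integers that grows over every period has an adjoint. -/
theorem exists_adjoint {K : ℤ → ℤ} {n N : ℕ} (hK : Monotone K) (hN : 0 < N)
    (hper : ∀ i, K (i + n) = K i + N) : ∃ o : ℤ → ℤ, ∀ i k, K i ≤ k ↔ i ≤ o k := by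
  have hz : ∀ z : ℤ, K (z * n) = K 0 + z * N := by
    intro z
    induction z using Int.induction_on with
    | zero => simp
    | succ z ih => rw [add_mul, one_mul, hper, ih]; ring
    | pred z ih =>
      have := hper ((-z - 1 : ℤ) * n)
      rw [show (-z - 1 : ℤ) * n + n = -z * n by ring, ih] at this
      linarith
  have key : ∀ k, ∃ b, ∀ i, K i ≤ k ↔ i ≤ b := by
    intro k
    -- Both bounds are multiples of `n`, where `K` is known by `hz`; each period adds at least 1 to
    -- `K`.
    obtain ⟨b, hb, hmax⟩ := Int.exists_greatest_of_bdd (P := fun i => K i ≤ k)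
      ⟨(k - K 0 + 1).toNat * n, fun i hi => by
        by_contra hlt
        have h1 := hK (not_le.1 hlt).le
        rw [hz] at h1
        have h2 : ((k - K 0 + 1).toNat : ℤ) ≤ (k - K 0 + 1).toNat * N :=
          le_mul_of_one_le_right (by lia) (by lia)
        lia⟩
      ⟨-(K 0 - k).toNat * n, by
        rw [hz]
        have h2 : ((K 0 - k).toNat : ℤ) ≤ (K 0 - k).toNat * N :=
          le_mul_of_one_le_right (by lia) (by lia)
        lia⟩
    exact ⟨b, fun i => ⟨hmax i, fun h => (hK h).trans hb⟩⟩
  choose o ho using key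
  exact ⟨o, fun i k => ho k i⟩

/-- Otherwise `q` would be constant on the nonnegative indices, producing arbitrarily long strings
of `{q 0}`. -/
theorem exists_ne_singleton (A : ℤ → Multiset ℕ) (q : ℤ → ℕ) (hmem : ∀ i, q i ∈ A i)
    (hthree : ∀ i, ∀ p ∈ A i, 3 ≤ p)
    (hskel : ∀ p, 3 ≤ p → ¬ ∃ i : ℤ, ∀ k : ℕ, k < p - 2 → A (i + k) = {p}) :
    ∃ i, A i ≠ {q (i - 1)} := by
  by_contra! hA
  have hc : ∀ i : ℕ, q i = q 0 := fun i => by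
    induction i with
    | zero => rfl
    | succ i ih =>
      have h := hmem (i + 1 : ℕ)
      rw [hA, Multiset.mem_singleton] at h
      rw [h, ← ih]
      congr 1
      lia
  refine hskel (q 0) (hthree 0 _ (hmem 0)) ⟨1, fun j _ => ?_⟩
  rw [hA, ← hc j]
  congr 2
  lia

/-! ### From fans to a sequence of arcs -/

/-- A periodic choice of fans at the outer vertices of the cover, such that the last subgon of the
fan at `i` can be the first one of the fan at `i + 1`. There are `K i` arcs before the fan at `i`,
and the `k`-th arc ends at the outer vertex `o k`. -/
structure FanSeq (n : ℕ) where
  A : ℤ → Multiset ℕ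
  q : ℤ → ℕ
  L : ℤ → ℕ
  F : ℤ → ℕ → ℕ × ℕ
  fan : ∀ i, IsFan (q (i - 1)) (q i) (A i) (L i) (F i)
  F_period : ∀ i, F (i + n) = F i
  three_le : ∀ i, ∀ p ∈ A i, 3 ≤ p
  skeletal : ∀ p, 3 ≤ p → ¬ ∃ i : ℤ, ∀ k : ℕ, k < p - 2 → A (i + k) = {p}
  K : ℤ → ℤ
  K_succ : ∀ i, K (i + 1) = K i + L i
  N : ℕ
  N_pos : 0 < N
  n_pos : 0 < n
  K_period : ∀ i, K (i + n) = K i + N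
  o : ℤ → ℤ
  K_le_iff : ∀ i k, K i ≤ k ↔ i ≤ o k

namespace FanSeq

variable {n : ℕ} (S : FanSeq n)

theorem lt_K_iff (i k : ℤ) : k < S.K i ↔ S.o k < i := by
  rw [← not_le, S.K_le_iff, not_le]

theorem K_mono : Monotone S.K := monotone_int_of_le_succ fun i => by rw [S.K_succ]; lia

theorem o_le (k : ℤ) : S.o k ≤ S.o (k + 1) := by
  rw [← S.K_le_iff]
  have := (S.K_le_iff (S.o k) k).2 le_rfl
  lia

theorem o_period (k : ℤ) : S.o (k + S.N) = S.o k + n := by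
  have h : ∀ i, i ≤ S.o (k + S.N) ↔ i ≤ S.o k + n := fun i => by
    have := S.K_period (i - n)
    rw [sub_add_cancel] at this
    rw [← S.K_le_iff, this, add_le_add_iff_right, S.K_le_iff, sub_le_iff_le_add]
  exact le_antisymm ((h _).1 le_rfl) ((h _).2 le_rfl)

/-- Size and tag of the `k`-th subgon. -/
def letter (k : ℤ) : ℕ × ℕ := S.F (S.o k) (k + 1 - S.K (S.o k)).toNat

theorem letter_period (k : ℤ) : S.letter (k + S.N) = S.letter k := by
  rw [letter, letter, S.o_period, S.F_period, S.K_period]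
  congr 2
  ring

theorem incident_iff (i k : ℤ) :
    S.o k ≤ i ∧ i ≤ S.o (k + 1) ↔ ∃ j ≤ S.L i, k = S.K i - 1 + j := by
  rw [← S.K_le_iff, ← Int.lt_add_one_iff, ← S.lt_K_iff, S.K_succ]
  constructor
  · intro h
    exact ⟨(k + 1 - S.K i).toNat, by lia, by lia⟩
  · rintro ⟨j, hj, rfl⟩
    lia

theorem A_eq_of_between {k i : ℤ} (h1 : S.o k < i) (h2 : i < S.o (k + 1)) :
    S.A i = {S.q (i - 1)} := by
  refine (S.fan i).eq_singleton ?_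
  rw [← S.lt_K_iff] at h1
  have h3 := (S.K_le_iff (i + 1) (k + 1)).2 h2
  rw [S.K_succ] at h3
  lia

/-- The vertices strictly between two consecutive arc ends carry no arc, so their multisets are
singletons and the size passes on from edge to edge. -/
theorem q_eq_of_between {k i : ℤ} (h1 : S.o k ≤ i) (h2 : i < S.o (k + 1)) :
    S.q i = S.q (S.o k) := by
  induction i, h1 using Int.leInduction with
  | base => rfl
  | succ i hi ih =>
    have hA := S.A_eq_of_between (k := k) (i := i + 1) (by lia) h2
    have hm := (S.fan (i + 1)).mem _ le_rfl
    rw [(S.fan (i + 1)).last, hA, Multiset.mem_singleton] at hm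
    rw [← ih (by lia), show S.q (i + 1) = _ from hm, add_sub_cancel_right]

theorem letter_eq_of_lt {k : ℤ} (h : S.o k < S.o (k + 1)) : S.letter k = (S.q (S.o k), 0) := by
  have h1 := (S.lt_K_iff (S.o k + 1) k).2 (by lia)
  have h2 := (S.K_le_iff (S.o k + 1) (k + 1)).2 h
  rw [S.K_succ] at h1 h2
  rw [letter, show (k + 1 - S.K (S.o k)).toNat = S.L (S.o k) by lia, (S.fan _).last]

/-- A subgon has the same letter in the fans of all its outer vertices. Only `j = 0` needs an
argument: this subgon starts at an earlier vertex, where it is the last of the fan, and `q` is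
constant along it. -/
theorem letter_eq {i : ℤ} {j : ℕ} (hj : j ≤ S.L i) : S.letter (S.K i - 1 + j) = S.F i j := by
  rcases Nat.eq_zero_or_pos j with rfl | hpos
  · have h1 := (S.incident_iff i _).2 ⟨0, hj, rfl⟩
    have h2 := (S.lt_K_iff i (S.K i - 1 + (0 : ℕ))).1 (by lia)
    rw [(S.fan i).first, S.letter_eq_of_lt (by lia), S.q_eq_of_between (i := i - 1)
      (k := S.K i - 1 + (0 : ℕ)) (by lia) (by lia)]
  · have h1 := (S.K_le_iff i (S.K i - 1 + j)).1 (by lia)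
    have h2 := (S.lt_K_iff (i + 1) (S.K i - 1 + j)).1 (by rw [S.K_succ]; lia)
    have h3 : S.o (S.K i - 1 + j) = i := by lia
    rw [letter, h3]
    congr 1
    lia

theorem letter_ne_succ (k : ℤ) : S.letter k ≠ S.letter (k + 1) := by
  obtain ⟨j, hj, hk⟩ := (S.incident_iff (S.o (k + 1)) k).1 ⟨S.o_le k, le_rfl⟩
  have h1 := (S.lt_K_iff (S.o (k + 1) + 1) (k + 1)).2 (by lia)
  rw [S.K_succ] at h1
  have h2 := S.letter_eq hj
  have h3 := S.letter_eq (i := S.o (k + 1)) (j := j + 1) (by lia)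
  rw [← hk] at h2
  rw [Nat.cast_add, Nat.cast_one, ← add_assoc, ← hk] at h3
  rw [h2, h3]
  exact (S.fan _).ne_succ j (by lia)

theorem three_le_letter (k : ℤ) : 3 ≤ (S.letter k).1 := by
  obtain ⟨j, hj, hk⟩ := (S.incident_iff (S.o k) k).1 ⟨le_rfl, S.o_le k⟩
  rw [hk, S.letter_eq hj]
  exact S.three_le _ _ ((S.fan _).mem j hj)

/-- A `p`-gon with more than `p - 2` outer edges would pass over `p - 2` consecutive vertices with
multiset `{p}`, which the skeletal condition forbids. -/
theorem sub_le (k : ℤ) : S.o (k + 1) - S.o k ≤ (S.letter k).1 - 2 := by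
  have h3 := S.three_le_letter k
  by_contra hlt
  have hl := S.letter_eq_of_lt (k := k) (by lia)
  rw [hl] at hlt h3
  simp only at hlt h3
  refine S.skeletal _ h3 ⟨S.o k + 1, fun j hj => ?_⟩
  rw [S.A_eq_of_between (k := k) (by lia) (by lia), S.q_eq_of_between (k := k) (by lia) (by lia)]

/-- Some multiset is not a singleton `{q (i - 1)}`, and its vertex receives at least two arcs. The
subgon between them has a single outer vertex. -/
theorem exists_lt : ∃ k, S.o (k + 1) = S.o k := by
  by_contra! h
  have hL : ∀ i, S.A i ≠ {S.q (i - 1)} → False := fun i hi => by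
    have hlen := (S.fan i).length hi
    have h1 := (S.incident_iff i (S.K i - 1 + 1)).2 ⟨1, by lia, rfl⟩
    have h2 := (S.K_le_iff i (S.K i - 1 + 1)).1 (by lia)
    have h3 := (S.lt_K_iff (i + 1) (S.K i - 1 + 1 + 1)).1 (by rw [S.K_succ]; lia)
    exact h (S.K i - 1 + 1) (by have := S.o_le (S.K i - 1 + 1); lia)
  obtain ⟨i, hi⟩ := exists_ne_singleton S.A S.q (fun i => by
    have := (S.fan i).mem _ le_rfl
    rwa [(S.fan i).last] at this) S.three_le S.skeletal
  exact hL i hi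

theorem exists_arcSeq : ∃ m : ℕ, 1 ≤ m ∧ ∃ T : ArcSeq n m S.N, T.o = S.o ∧
    ∀ k, (T.gon k).card = (S.letter k).1 := by
  obtain ⟨t, ht⟩ := exists_antidifference fun k => (S.letter k).1 - 2 - (S.o (k + 1) - S.o k)
  have htle : ∀ k, t k ≤ t (k + 1) := fun k => by
    have := S.sub_le k
    rw [ht]
    lia
  have hmono : Monotone t := monotone_int_of_le_succ htle
  have hper := add_period_of_antidifference (N := S.N) ht (fun k => by
    rw [S.letter_period, add_right_comm, S.o_period, S.o_period]; ring)
  obtain ⟨k, hk⟩ := S.exists_lt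
  -- A subgon with one outer vertex and size `p` contributes `p - 2 ≥ 1` inner edges to every
  -- period.
  have hpos : 1 ≤ t S.N - t 0 := by
    have h1 := ht k
    have h2 := S.three_le_letter k
    have h3 := hmono (show k + 1 ≤ k + S.N by have := S.N_pos; lia)
    have h4 := hper k
    lia
  refine ⟨(t S.N - t 0).toNat, by lia, ⟨S.o, t, S.o_le, htle, fun k => ?_, S.o_period,
    fun k => ?_⟩, rfl, fun k => ?_⟩
  · have := S.three_le_letter k
    rw [ht]
    lia
  · rw [hper]
    lia
  · have h1 := ArcSeq.card_gon ⟨S.o, t, S.o_le, htle, fun k => by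
      have := S.three_le_letter k
      rw [ht]
      lia, S.o_period, fun k => by rw [hper]; lia⟩ k (m := (t S.N - t 0).toNat)
    have h2 := ht k
    simp only at h1
    lia

/-! ### Identifying subgons with equal letters -/

variable {m : ℕ} (T : ArcSeq n m S.N)

/-- The pairs of subgons that get identified: those with the same size and tag that are different
in the surface and share an outer vertex. -/
def Glue (V W : Finset (ℤ ⊕ ℤ)) : Prop :=
  ∃ k l : ℤ, V = T.gon k ∧ W = T.gon l ∧ S.letter k = S.letter l ∧ (∀ z : ℤ, l ≠ k + z * S.N) ∧
    ∃ i z : ℤ, Sum.inl i ∈ T.gon k ∧ Sum.inl i ∈ T.gon (l + z * S.N)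

theorem letter_zsmul (k z : ℤ) : S.letter (k + z * S.N) = S.letter k := by
  induction z using Int.induction_on with
  | zero => simp
  | succ z ih => rw [add_mul, one_mul, ← add_assoc, S.letter_period, ih]
  | pred z ih =>
    rw [← ih, ← S.letter_period]
    congr 1
    ring

/-- The letter is an invariant of iterated identification. The alternative `V = W` covers sets that
are not subgons. -/
theorem letter_eq_of_eqvGen {V W : Finset (ℤ ⊕ ℤ)} (h : Relation.EqvGen (S.Glue T) V W) :
    V = W ∨ ∃ k l, V = T.gon k ∧ W = T.gon l ∧ S.letter k = S.letter l := by
  induction h with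
  | rel V W h =>
    obtain ⟨k, l, hV, hW, h, -⟩ := h
    exact Or.inr ⟨k, l, hV, hW, h⟩
  | refl V => exact Or.inl rfl
  | symm V W _ ih =>
    rcases ih with h | ⟨k, l, hV, hW, h⟩
    · exact Or.inl h.symm
    · exact Or.inr ⟨l, k, hW, hV, h.symm⟩
  | trans U V W _ _ ih1 ih2 =>
    rcases ih1 with rfl | ⟨k, l, hU, hV, h⟩
    · exact ih2
    · rcases ih2 with rfl | ⟨k', l', hV', hW, h'⟩
      · exact Or.inr ⟨k, l, hU, hV, h⟩
      · obtain rfl := T.gon_injective (hV.symm.trans hV')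
        exact Or.inr ⟨k, l', hU, hW, h.trans h'⟩

theorem letter_eq_of_eqvGen_gon {k l : ℤ} (h : Relation.EqvGen (S.Glue T) (T.gon k) (T.gon l)) :
    S.letter k = S.letter l := by
  rcases S.letter_eq_of_eqvGen T h with h | ⟨k', l', hk, hl, h⟩
  · rw [T.gon_injective h]
  · rwa [T.gon_injective hk, T.gon_injective hl]

theorem L_le (i : ℤ) : S.L i ≤ S.N := by
  have h := S.K_mono (show i + 1 ≤ i + n by have := S.n_pos; lia)
  rw [S.K_succ, S.K_period] at h
  lia

variable {T}

theorem glue_of_lt (hT : T.o = S.o) {i : ℤ} {j j' : ℕ} (hj' : j' ≤ S.L i) (hlt : j < j')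
    (hN : j' < j + S.N) (h : S.F i j = S.F i j') :
    S.Glue T (T.gon (S.K i - 1 + j)) (T.gon (S.K i - 1 + j')) := by
  refine ⟨_, _, rfl, rfl, ?_, fun z hz => ?_, i, 0, ?_, ?_⟩
  · rw [S.letter_eq hj', S.letter_eq (by lia), h]
  · have h1 : (0 : ℤ) < z := by
      by_contra! h0
      have := mul_nonpos_of_nonpos_of_nonneg h0 (Int.natCast_nonneg S.N)
      lia
    have := le_mul_of_one_le_left (Int.natCast_nonneg S.N) h1
    lia
  · rw [T.inl_mem_gon, hT, S.incident_iff]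
    exact ⟨j, by lia, rfl⟩
  · rw [T.inl_mem_gon, hT, S.incident_iff]
    exact ⟨j', hj', by lia⟩

/-- Fewer than `N` steps apart, the subgons differ in the surface and are glued directly. Otherwise
they are the two ends of a fan with `L i = N`, hence lifts of one subgon, and are linked through the
intermediate copy. -/
theorem eqvGen_of_lt (hT : T.o = S.o) {i : ℤ} {j j' : ℕ} (hj' : j' ≤ S.L i) (hlt : j < j')
    (h : S.F i j = S.F i j') :
    Relation.EqvGen (S.Glue T) (T.gon (S.K i - 1 + j)) (T.gon (S.K i - 1 + j')) := by
  have hL := S.L_le i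
  by_cases hN : j' < j + S.N
  · exact .rel _ _ (S.glue_of_lt hT hj' hlt hN h)
  · obtain rfl : j = 0 := by lia
    obtain rfl : j' = S.L i := by lia
    have hpq := congrArg Prod.fst h
    rw [(S.fan i).first, (S.fan i).last] at hpq
    obtain ⟨l, hl0, hlL, hl⟩ := (S.fan i).middle (by lia) hpq
    exact .trans _ _ _ (.rel _ _ (S.glue_of_lt hT hlL.le hl0 (by lia) hl.symm))
      (.rel _ _ (S.glue_of_lt hT le_rfl hlL (by lia) (hl.trans h)))

theorem eqvGen_of_eq (hT : T.o = S.o) {i : ℤ} {j j' : ℕ} (hj : j ≤ S.L i) (hj' : j' ≤ S.L i)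
    (h : S.F i j = S.F i j') :
    Relation.EqvGen (S.Glue T) (T.gon (S.K i - 1 + j)) (T.gon (S.K i - 1 + j')) := by
  rcases lt_trichotomy j j' with hlt | rfl | hlt
  · exact S.eqvGen_of_lt hT hj' hlt h
  · exact .refl _
  · exact .symm _ _ (S.eqvGen_of_lt hT hj hlt h.symm)

/-- The subgons with the given fans, identified according to their sizes and tags, form a quotient
dissection that realizes the sums over the multisets `A i`. -/
theorem realizable {a : ℤ → ℝ} (ha : ∀ i, a i = ((S.A i).map lam).sum) :
    RealizableByQuotient n a := by
  obtain ⟨m, hm, T, hT, hcard⟩ := S.exists_arcSeq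
  refine ⟨m, hm, { T.dissection with
    glue := S.Glue T
    glue_translate := ?_
    glue_subgon := ?_
    glue_distinct := ?_
    glue_size := ?_
    glue_outer_vertex := ?_
    glue_inner_vertex := ?_
    not_shareEdge := ?_ }, ?_⟩
  · rintro _ _ ⟨k, l, rfl, rfl, h, hne, i, z, hi, hz⟩ x y
    rw [T.translate_gon, T.translate_gon]
    -- The common vertex moves by `x` periods with the first subgon; the second one has already
    -- moved by `y`, so it lacks `x - y + z`.
    refine ⟨_, _, rfl, rfl, by rw [S.letter_zsmul, S.letter_zsmul, h], fun w hw => ?_,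
      i + x * n, x - y + z, ?_, ?_⟩
    · exact hne (x + w - y) (by linear_combination hw)
    · rw [T.inl_mem_gon] at hi ⊢
      have h1 := (T.period_zsmul x k).1
      have h2 := (T.period_zsmul x (k + 1)).1
      rw [add_right_comm] at h2
      lia
    · rw [T.inl_mem_gon] at hz ⊢
      have h1 := (T.period_zsmul x (l + z * S.N)).1
      have h2 := (T.period_zsmul x (l + z * S.N + 1)).1
      rw [show l + y * S.N + (x - y + z) * S.N = l + z * S.N + x * S.N by ring]
      rw [add_right_comm] at h2
      lia
  · rintro _ _ ⟨k, l, rfl, rfl, -⟩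
    exact ⟨T.isSubgon_gon k, T.isSubgon_gon l⟩
  · rintro _ _ ⟨k, l, rfl, rfl, -, hne, -⟩ z hz
    rw [T.translate_gon] at hz
    exact hne z (T.gon_injective hz)
  · rintro _ _ ⟨k, l, rfl, rfl, h, -⟩
    rw [hcard, hcard, h]
  · rintro _ _ ⟨k, l, rfl, rfl, -, -, i, z, hi, hz⟩
    exact ⟨i, z, hi, by rwa [T.translate_gon]⟩
  · rintro _ _ ⟨k, l, rfl, rfl, -⟩
    exact ⟨⟨T.t k, T.inr_mem_gon.2 ⟨le_rfl, T.t_le k⟩⟩,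
      ⟨T.t l, T.inr_mem_gon.2 ⟨le_rfl, T.t_le l⟩⟩⟩
  · intro V W h hne hE
    rcases S.letter_eq_of_eqvGen T h with rfl | ⟨k, l, rfl, rfl, hkl⟩
    · exact hne 0 (translate_zero n m _).symm
    · rcases lt_trichotomy k l with hlt | rfl | hlt
      · obtain rfl := T.eq_succ_of_shareEdge hlt hE
        exact S.letter_ne_succ k hkl
      · exact hne 0 (translate_zero n m _).symm
      · obtain ⟨x, y, hx, hy, hx', hy', he⟩ := hE
        obtain rfl := T.eq_succ_of_shareEdge hlt ⟨x, y, hx', hy', hx, hy, he⟩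
        exact S.letter_ne_succ l hkl.symm
  · intro i
    -- One position per letter of the fan gives the system of representatives.
    have hex : ∀ ℓ : ℕ × ℕ, ∃ j, ℓ ∈ (Finset.range (S.L i + 1)).image (S.F i) →
        j ≤ S.L i ∧ S.F i j = ℓ := fun ℓ => by
      by_cases h : ℓ ∈ (Finset.range (S.L i + 1)).image (S.F i)
      · obtain ⟨j, hj, h⟩ := Finset.mem_image.1 h
        exact ⟨j, fun _ => ⟨by rw [Finset.mem_range] at hj; lia, h⟩⟩
      · exact ⟨0, fun h' => absurd h' h⟩
    choose g hg using hex
    have hletter : ∀ ℓ ∈ (Finset.range (S.L i + 1)).image (S.F i),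
        S.letter (S.K i - 1 + g ℓ) = ℓ := fun ℓ hℓ => by
      rw [S.letter_eq (hg ℓ hℓ).1, (hg ℓ hℓ).2]
    refine ⟨((Finset.range (S.L i + 1)).image (S.F i)).image
      fun ℓ => T.gon (S.K i - 1 + g ℓ), ?_, ?_, ?_⟩
    · intro V hV
      obtain ⟨ℓ, hℓ, rfl⟩ := Finset.mem_image.1 hV
      refine ⟨T.isSubgon_gon _, ?_⟩
      rw [T.inl_mem_gon, hT, S.incident_iff]
      exact ⟨g ℓ, (hg ℓ hℓ).1, rfl⟩
    · intro V hV hiV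
      obtain ⟨k, rfl⟩ := T.exists_eq_gon hV
      rw [T.inl_mem_gon, hT, S.incident_iff] at hiV
      obtain ⟨j, hj, rfl⟩ := hiV
      have hmem : S.F i j ∈ (Finset.range (S.L i + 1)).image (S.F i) :=
        Finset.mem_image_of_mem _ (Finset.mem_range.2 (by lia))
      refine ⟨T.gon (S.K i - 1 + g (S.F i j)), ⟨Finset.mem_image_of_mem _ hmem,
        S.eqvGen_of_eq hT hj (hg _ hmem).1 (hg _ hmem).2.symm⟩, ?_⟩
      rintro W ⟨hW, hr⟩
      obtain ⟨ℓ, hℓ, rfl⟩ := Finset.mem_image.1 hW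
      have h := S.letter_eq_of_eqvGen_gon T hr
      rw [hletter ℓ hℓ, S.letter_eq hj] at h
      rw [h]
    · rw [Finset.sum_image, ha, ← (S.fan i).sum_eq]
      · exact Finset.sum_congr rfl fun ℓ hℓ => by rw [hcard, hletter ℓ hℓ]
      · intro ℓ hℓ ℓ' hℓ' h
        rw [← hletter ℓ hℓ, ← hletter ℓ' hℓ', T.gon_injective h]

end FanSeq

/-! ### Existence of a periodic choice of fans -/

theorem exists_fanSeq {P : Finset ℕ} (hP : ∀ p ∈ P, 3 ≤ p) {n : ℕ} (hn : 1 ≤ n) {a : ℤ → ℝ}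
    {A : ℤ → Multiset ℕ} (hA : IsTypeLambda P n a A) (hskel : IsSkeletal a)
    (hinter : ∀ i, A i ∩ A (i + 1) ≠ 0) : ∃ S : FanSeq n, S.A = A := by
  have h3 : ∀ i, ∀ p ∈ A i, 3 ≤ p := fun i p hp => hP p (hA.mem i p hp)
  have hsk : ∀ p, 3 ≤ p → ¬ ∃ i : ℤ, ∀ k : ℕ, k < p - 2 → A (i + k) = {p} := by
    rintro p hp ⟨i, hi⟩
    exact hskel p hp ⟨i, fun k hk => by rw [hA.eq_sum, hi k hk]; simp⟩
  -- Common elements and fans are chosen as functions of the multisets and sizes, not of the index,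
  -- so that they inherit the period `n`.
  have hcommon : ∀ X Y : Multiset ℕ, ∃ r, X ∩ Y ≠ 0 → r ∈ X ∧ r ∈ Y := fun X Y => by
    by_cases h : X ∩ Y = 0
    · exact ⟨0, fun h' => absurd h h'⟩
    · obtain ⟨r, hr⟩ := Multiset.exists_mem_of_ne_zero h
      exact ⟨r, fun _ => Multiset.mem_inter.1 hr⟩
  choose c hc using hcommon
  have hfan : ∀ (p q : ℕ) (X : Multiset ℕ), ∃ L F, p ∈ X → q ∈ X → IsFan p q X L F :=
    fun p q X => by
      by_cases h : p ∈ X ∧ q ∈ X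
      · obtain ⟨L, F, hF⟩ := exists_isFan p q X h.1 h.2
        exact ⟨L, F, fun _ _ => hF⟩
      · exact ⟨0, fun _ => (0, 0), fun h1 h2 => absurd ⟨h1, h2⟩ h⟩
  choose L F hF using hfan
  set q : ℤ → ℕ := fun i => c (A i) (A (i + 1)) with hq
  have hq1 : ∀ i, q i ∈ A i := fun i => (hc _ _ (hinter i)).1
  have hq2 : ∀ i, q (i - 1) ∈ A i := fun i => by
    simpa [hq] using (hc _ _ (hinter (i - 1))).2
  have hqper : ∀ i, q (i + n) = q i := fun i => by
    simp only [hq, hA.periodic, add_right_comm i (n : ℤ) 1]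
  have hqper' : ∀ i, q (i + n - 1) = q (i - 1) := fun i => by
    rw [← hqper (i - 1)]
    congr 1
    ring
  obtain ⟨K, hK⟩ := exists_antidifference fun i => (L (q (i - 1)) (q i) (A i) : ℤ)
  have hKm : Monotone K := monotone_int_of_le_succ fun i => by rw [hK]; lia
  have hKper := add_period_of_antidifference (N := n) hK fun i => by
    rw [hqper, hqper', hA.periodic]
  have hN : 0 < K n - K 0 := by
    obtain ⟨i, hi⟩ := exists_ne_singleton A q hq1 h3 hsk
    have h1 := (hF _ _ _ (hq2 i) (hq1 i)).length hi
    have h2 := hKm (show i + 1 ≤ i + n by lia)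
    rw [hKper, hK] at h2
    lia
  have hKper' : ∀ i, K (i + n) = K i + (K n - K 0).toNat := fun i => by
    rw [hKper]
    lia
  obtain ⟨o, ho⟩ := exists_adjoint hKm (N := (K n - K 0).toNat) (by lia) hKper'
  exact ⟨{
    A := A
    q := q
    L := fun i => L (q (i - 1)) (q i) (A i)
    F := fun i => F (q (i - 1)) (q i) (A i)
    fan := fun i => hF _ _ _ (hq2 i) (hq1 i)
    F_period := fun i => by simp only [hqper, hqper', hA.periodic]
    three_le := h3
    skeletal := hsk
    K := K
    K_succ := hK
    N := (K n - K 0).toNat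
    N_pos := by lia
    n_pos := hn
    K_period := hKper'
    o := o
    K_le_iff := ho }, rfl⟩

end Frieze

theorem mainTheorem1 (P : Finset ℕ) (hP : ∀ p ∈ P, 3 ≤ p) (n : ℕ) (hn : 1 ≤ n)
    (m : ℤ → ℤ → ℝ) (hm : Frieze.IsInfiniteFrieze m)
    (A : ℤ → Multiset ℕ) (hA : Frieze.IsTypeLambda P n (Frieze.quiddity m) A)
    (hskel : Frieze.IsSkeletal (Frieze.quiddity m))
    (htest : Frieze.PassesRealizabilityTest A) :
    Frieze.RealizableByPuncturedDisc n (Frieze.quiddity m) ∨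
      Frieze.RealizableByAnnulus n (Frieze.quiddity m) ∨
      Frieze.RealizableByQuotient n (Frieze.quiddity m) := by
  obtain ⟨S, hS⟩ := Frieze.exists_fanSeq hP hn hA hskel fun i h => htest.1 ⟨i, h⟩
  exact Or.inr (Or.inr (S.realizable fun i => by rw [hA.eq_sum, hS]))
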